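/- A layered episodic MDP with $H$ layers, $M$ states per layer and $K$ actions consists of pairwise disjoint sets of states $\mathcal S_1,\dots,\mathcal S_H$ with $|\mathcal S_h|=M$, a set $\mathcal A$ of $K$ actions, an initial distribution $\Gamma_1\in\Delta(\mathcal S_1)$, transition distributions $\Gamma(s,a)\in\Delta(\mathcal S_{h+1})$ for $s\in\mathcal S_h$, $a\in\mathcal A$, $h<H$ (transitions from $\mathcal S_H$ are terminal), and reward distributions $R(s,a)$ on $\mathbb R$, such that, regardless of how the actions of an episode are chosen, almost surely $r_h\ge 0$ for all $h$ and $\sum_{h=1}^H r_h\le 1$. In an episode, $s_1\sim\Gamma_1$, and for $h=1,\dots,H$ an action $a_h$ is chosen, a reward $r_h\sim R(s_h,a_h)$ is received, and (if $h<H$) $s_{h+1}\sim\Gamma(s_h,a_h)$ is drawn; the trajectory is $(s_1,a_1,r_1,\dots,s_H,a_H,r_H)$. A policy is a map $\pi:\mathcal S_1\cup\dots\cup\mathcal S_H\to\mathcal A$; its value $V(\pi)$ is the expectation of $\sum_{h=1}^H r_h$ when $a_h=\pi(s_h)$ for all $h$, and $V^\star=\max_\pi V(\pi)$. An algorithm that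 collects $n$ trajectories runs $n$ independently initialized episodes one after the other, chooses each action, possibly at random, depending on everything observed so far, and then outputs, possibly at random, a policy $\hat\pi$ depending on the $n$ trajectories. The state sets $\mathcal S_h$ and the action set are known to the algorithm; $\Gamma_1,\Gamma,R$ are not. **Theorem.** There is a universal constant $c>0$ such that the following holds. Let $M\ge 4$, $H\ge2$, $K\ge 2$ be integers and let $\epsilon\in\bigl(0,\tfrac{1}{48\sqrt 8}\bigr)$. For every integer $n$ with $0\le n\le cMKH/\epsilon^2$ and every algorithm that collects $n$ trajectories, there exists a layered episodic MDP with $H$ layers, $M$ states per layer and $K$ actions such that the probability that the algorithm outputs a policy $\hat\pi$ with $V(\hat\pi)\ge V^\star-\epsilon$ after collecting $n$ trajectories is at most $11/12$. -/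

import Mathlib

open MeasureTheory ProbabilityTheory
open scoped ENNReal

namespace EpisodicRL

/-- One step of interaction: the observed state (an element of `Fin M`, its layer being known from
the time), the action taken and the instantaneous reward received. -/
abbrev Step (M K : ℕ) : Type := Fin M × Fin K × ℝ

/-- The record of the first `t` steps of interaction. -/
abbrev History (M K t : ℕ) : Type := Fin t → Step M K

/-- A layered episodic MDP with `H` layers (numbered `0, …, H - 1`), `M` states per layer
(the state space is the disjoint union of `H` copies of `Fin M`) and `K` actions.
`trans h` is the transition function from layer `h` to layer `h + 1`; the transitions from the last
layer are terminal, so there are `H - 1` of them. `reward h (s, a)` is the distribution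
of the random reward for taking action `a` in state `s` of layer `h`. -/
structure LayeredMDP (H M K : ℕ) where
  init : Measure (Fin M)
  trans : Fin (H - 1) → Kernel (Fin M × Fin K) (Fin M)
  reward : Fin H → Kernel (Fin M × Fin K) ℝ
  init_prob : IsProbabilityMeasure init
  trans_markov : ∀ h, IsMarkovKernel (trans h)
  reward_markov : ∀ h, IsMarkovKernel (reward h)

/-- A (randomized, history-dependent) rule for choosing actions: at time `t` it maps the record of
all earlier steps and the current state to a distribution over actions. -/
structure Strategy (M K : ℕ) where
  act : (t : ℕ) → Kernel (History M K t × Fin M) (Fin K)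
  markov : ∀ t, IsMarkovKernel (act t)

attribute [instance] LayeredMDP.init_prob LayeredMDP.trans_markov LayeredMDP.reward_markov
  Strategy.markov

/-- A policy: a map from states (of every layer) to actions. -/
abbrev Policy (H M K : ℕ) : Type := Fin H → Fin M → Fin K

/-- The layer of the state visited at time `t`, when episodes of `H` steps are run one after the
other: time `t` is step `t % H` of episode `t / H`. -/
def layer (H : ℕ) [NeZero H] (t : ℕ) : Fin H := ⟨t % H, Nat.mod_lt t (NeZero.pos H)⟩

/-- Following a policy, regarded as a strategy. -/
noncomputable def Policy.toStrategy {H M K : ℕ} [NeZero H] (π : Policy H M K) : Strategy M K where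
  act t := Kernel.deterministic (fun x : History M K t × Fin M => π (layer H t) x.2)
    ((measurable_of_countable (π (layer H t))).comp measurable_snd)
  markov _ := inferInstance

namespace LayeredMDP

variable {H M K : ℕ} [NeZero H]

/-- The conditional distribution of the state at time `t`, given the earlier steps: the initial
distribution if a new episode starts at time `t`, and otherwise the transition from the previous
state and action. -/
noncomputable def stateKernel (mdp : LayeredMDP H M K) :
    (t : ℕ) → Kernel (History M K t) (Fin M)
  | 0 => Kernel.const _ mdp.init
  | t + 1 =>
    if h0 : (t + 1) % H = 0 then Kernel.const _ mdp.init
    else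
      (mdp.trans ⟨(t + 1) % H - 1, by
        have := Nat.mod_lt (t + 1) (NeZero.pos H); omega⟩).comap
        (fun x : History M K (t + 1) => ((x (Fin.last t)).1, (x (Fin.last t)).2.1))
        (by fun_prop)

/-- The conditional distribution of the step (state, action, reward) at time `t`, given the earlier
steps, when the actions are chosen by `σ`. -/
noncomputable def stepKernel (mdp : LayeredMDP H M K) (σ : Strategy M K) (t : ℕ) :
    Kernel (History M K t) (Step M K) :=
  Kernel.compProd (mdp.stateKernel t)
    (Kernel.compProd (σ.act t)
      ((mdp.reward (layer H t)).comap
        (fun x : (History M K t × Fin M) × Fin K => (x.1.2, x.2)) (by fun_prop)))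

/-- The joint distribution of the first `t` steps when the actions are chosen by `σ`. In particular
`mdp.law σ (n * H)` is the joint distribution of the first `n` trajectories. -/
noncomputable def law (mdp : LayeredMDP H M K) (σ : Strategy M K) :
    (t : ℕ) → Measure (History M K t)
  | 0 => Measure.dirac Fin.elim0
  | t + 1 => (Measure.compProd (law mdp σ t) (mdp.stepKernel σ t)).map
      (fun p => Fin.snoc (α := fun _ => Step M K) p.1 p.2)

/-- Regardless of how the actions of an episode are chosen, almost surely all its rewards are
nonnegative and their sum is at most one. -/
def BoundedRewards (mdp : LayeredMDP H M K) : Prop :=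
  ∀ σ : Strategy M K, ∀ᵐ x ∂(mdp.law σ H), (∀ h, 0 ≤ (x h).2.2) ∧ ∑ h, (x h).2.2 ≤ 1

/-- The value of a policy: the expected sum of rewards in one episode. -/
noncomputable def value (mdp : LayeredMDP H M K) (π : Policy H M K) : ℝ :=
  ∫ x, ∑ h, (x h).2.2 ∂(mdp.law π.toStrategy H)

/-- The optimal value `V⋆`: the largest value of one of the (finitely many) policies. -/
noncomputable def optValue (mdp : LayeredMDP H M K) : ℝ :=
  ⨆ π : Policy H M K, mdp.value π

end LayeredMDP

/-- A (randomized) learning algorithm that collects `n` trajectories of `H` steps each, choosing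
every action on the basis of everything observed so far, and then outputs a policy. -/
structure Algorithm (H M K n : ℕ) extends Strategy M K where
  output : Kernel (History M K (n * H)) (Policy H M K)
  output_markov : IsMarkovKernel output

/-- The distribution of the policy output by the algorithm when run on `mdp`. -/
noncomputable def Algorithm.outputLaw {H M K n : ℕ} [NeZero H] (alg : Algorithm H M K n)
    (mdp : LayeredMDP H M K) : Measure (Policy H M K) :=
  (mdp.law alg.toStrategy (n * H)).bind alg.output

/-! The objects above are genuine probability kernels and measures. -/

instance {H M K : ℕ} [NeZero H] (mdp : LayeredMDP H M K) (t : ℕ) :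
    IsMarkovKernel (mdp.stateKernel t) := by
  cases t with
  | zero => unfold LayeredMDP.stateKernel; infer_instance
  | succ t => rw [LayeredMDP.stateKernel]; split_ifs <;> infer_instance

instance {H M K : ℕ} [NeZero H] (mdp : LayeredMDP H M K) (σ : Strategy M K) (t : ℕ) :
    IsMarkovKernel (mdp.stepKernel σ t) := by
  unfold LayeredMDP.stepKernel; infer_instance

theorem measurable_snoc {M K t : ℕ} : Measurable (fun p : History M K t × Step M K =>
    (Fin.snoc (α := fun _ => Step M K) p.1 p.2 : History M K (t + 1))) := by
  refine measurable_pi_lambda _ fun i => ?_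
  induction i using Fin.lastCases with
  | last => simpa using measurable_snd
  | cast i =>
    simp only [Fin.snoc_castSucc]
    fun_prop

instance {H M K : ℕ} [NeZero H] (mdp : LayeredMDP H M K) (σ : Strategy M K) (t : ℕ) :
    IsProbabilityMeasure (mdp.law σ t) := by
  induction t with
  | zero => unfold LayeredMDP.law; infer_instance
  | succ t ih =>
    unfold LayeredMDP.law
    exact Measure.isProbabilityMeasure_map measurable_snoc.aemeasurable

instance {H M K n : ℕ} [NeZero H] (alg : Algorithm H M K n) (mdp : LayeredMDP H M K) :
    IsProbabilityMeasure (alg.outputLaw mdp) := by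
  have := alg.output_markov
  unfold Algorithm.outputLaw; infer_instance

end EpisodicRL

/-! In the hard instances every layer has m = M - 2 active states and two absorbing ones, and only
ending in the good absorbing state pays. An active state is left with probability q = 1/(2H), and
then for the good state with probability 1/2, or 1/2 + δ if the action is the one prescribed by a
hidden policy θ; otherwise the next active state is uniform. So actions do not influence which
active states are visited, the value is a sum of separate contributions (`value_hardMDP`), and each
of the up to (H - 1)m wrong actions costs at least δ/(4Hm) (`value_gap`). With δ = 32ε, an ε-optimal
policy disagrees with θ in at most a quarter of these states.

A visit reveals relative entropy at most 4qδ² = 2δ²/H about the action tried, and a given state is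
visited with probability at most 1/m per episode. Hence n episodes give a total of at most
2nδ²/(Hm), shared by the K actions (`sum_visitCost_le`). Finding the right action needs a total of
order K, that is, n of order mKH/ε². The change of measure `lintegral_law_le_add` makes this precise
by comparing with an instance that is neutral in the state considered.

For uniformly random θ each state is then missed with probability at least 1/3 (`sum_prob_ne_ge`),
whereas success with probability above 11/12 for every θ would bound the expected fraction of
mismatches strictly by 1/4 + 1/12 = 1/3. -/

namespace EpisodicRL

variable {H M K : ℕ} [NeZero H]

/-! ### Integration over histories, one step at a time -/

namespace LayeredMDP

/-- The conditional distribution of action and reward at time `t`, given the earlier steps and the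
current state. -/
noncomputable def responseKernel (mdp : LayeredMDP H M K) (σ : Strategy M K) (t : ℕ) :
    Kernel (History M K t × Fin M) (Fin K × ℝ) :=
  Kernel.compProd (σ.act t)
    ((mdp.reward (layer H t)).comap
      (fun x : (History M K t × Fin M) × Fin K => (x.1.2, x.2)) (by fun_prop))

instance (mdp : LayeredMDP H M K) (σ : Strategy M K) (t : ℕ) :
    IsMarkovKernel (mdp.responseKernel σ t) := by
  unfold responseKernel; infer_instance

/-- Separating the new state from the response isolates the only factor in which two models with
equal rewards differ. -/
theorem lintegral_law_succ (mdp : LayeredMDP H M K) (σ : Strategy M K) (t : ℕ)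
    {f : History M K (t + 1) → ℝ≥0∞} (hf : Measurable f) :
    ∫⁻ x, f x ∂mdp.law σ (t + 1) =
      ∫⁻ x, ∫⁻ s, ∫⁻ z, f (Fin.snoc (α := fun _ => Step M K) x (s, z))
        ∂mdp.responseKernel σ t (x, s) ∂mdp.stateKernel t x ∂mdp.law σ t := by
  rw [law, lintegral_map hf measurable_snoc]
  refine (Measure.lintegral_compProd (hf.comp measurable_snoc)).trans ?_
  refine lintegral_congr fun x => ?_
  rw [stepKernel, Kernel.lintegral_compProd]
  · rfl
  · exact hf.comp (measurable_snoc.comp measurable_prodMk_left)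

theorem measurable_lintegral_response (mdp : LayeredMDP H M K) (σ : Strategy M K) (t : ℕ)
    {f : History M K (t + 1) → ℝ≥0∞} (hf : Measurable f) :
    Measurable fun p : History M K t × Fin M =>
      ∫⁻ z, f (Fin.snoc (α := fun _ => Step M K) p.1 (p.2, z)) ∂mdp.responseKernel σ t p := by
  refine Measurable.lintegral_kernel_prod_right' (κ := mdp.responseKernel σ t)
    (f := fun q : (History M K t × Fin M) × (Fin K × ℝ) =>
      f (Fin.snoc (α := fun _ => Step M K) q.1.1 (q.1.2, q.2))) ?_
  exact hf.comp (measurable_snoc.comp (by fun_prop :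
    Measurable fun q : (History M K t × Fin M) × (Fin K × ℝ) => (q.1.1, (q.1.2, q.2))))

/-- Integrating a function of the earlier steps and the current state. -/
theorem lintegral_law_succ_state (mdp : LayeredMDP H M K) (σ : Strategy M K) (t : ℕ)
    {g : History M K t → Fin M → ℝ≥0∞} (hg : Measurable g.uncurry) :
    ∫⁻ x, g (Fin.init x) (x (Fin.last t)).1 ∂mdp.law σ (t + 1) =
      ∫⁻ x, ∫⁻ s, g x s ∂mdp.stateKernel t x ∂mdp.law σ t := by
  rw [lintegral_law_succ]
  · simp [Fin.init_snoc]
  · exact hg.comp (f := fun x : History M K (t + 1) => (Fin.init x, (x (Fin.last t)).1)) <|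
      Measurable.prodMk (measurable_pi_lambda _ fun i => measurable_pi_apply _) (by fun_prop)

end LayeredMDP

/-! ### Likelihood ratios and relative entropy -/

/-- The likelihood ratio of a record of `t` steps, given that of each new state. -/
noncomputable def likelihood (l : (t : ℕ) → History M K t → Fin M → ℝ) :
    (t : ℕ) → History M K t → ℝ
  | 0, _ => 1
  | t + 1, x => likelihood l t (Fin.init x) * l t (Fin.init x) (x (Fin.last t)).1

theorem measurable_init {t : ℕ} :
    Measurable fun x : History M K (t + 1) => (Fin.init x : History M K t) :=
  measurable_pi_lambda _ fun _ => measurable_pi_apply _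

section Likelihood

variable {l : (t : ℕ) → History M K t → Fin M → ℝ}

theorem measurable_likelihood (hl : ∀ t, Measurable (l t).uncurry) (t : ℕ) :
    Measurable (likelihood l t) := by
  induction t with
  | zero => exact measurable_const
  | succ t ih =>
    exact (ih.comp measurable_init).mul ((hl t).comp
      (f := fun x : History M K (t + 1) => (Fin.init x, (x (Fin.last t)).1))
      (measurable_init.prodMk (by fun_prop)))

theorem likelihood_pos (hpos : ∀ t x s, 0 < l t x s) (t : ℕ) (x : History M K t) :
    0 < likelihood l t x := by
  induction t with
  | zero => exact one_pos
  | succ t ih => exact mul_pos (ih _) (hpos _ _ _)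

variable {A B : LayeredMDP H M K}

/-- Strategy and rewards are common to both models, so their factors cancel and only the ratios of
the state kernels accumulate. -/
theorem lintegral_law_eq_lintegral_likelihood (hr : A.reward = B.reward)
    (hl : ∀ t, Measurable (l t).uncurry) (hpos : ∀ t x s, 0 < l t x s)
    (hAB : ∀ t x s, B.stateKernel t x {s} = ENNReal.ofReal (l t x s) * A.stateKernel t x {s})
    (σ : Strategy M K) (t : ℕ) {f : History M K t → ℝ≥0∞} (hf : Measurable f) :
    ∫⁻ x, f x ∂B.law σ t = ∫⁻ x, ENNReal.ofReal (likelihood l t x) * f x ∂A.law σ t := by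
  induction t with
  | zero => simp [likelihood, LayeredMDP.law]
  | succ t ih =>
    have hresp : B.responseKernel σ t = A.responseKernel σ t := by
      simp only [LayeredMDP.responseKernel, hr]
    have hm := (measurable_likelihood hl (t + 1)).ennreal_ofReal
    rw [LayeredMDP.lintegral_law_succ _ _ _ hf, ih]
    · refine Eq.trans ?_ (LayeredMDP.lintegral_law_succ _ _ _ (hm.mul hf)).symm
      simp only [Pi.mul_apply]
      refine lintegral_congr fun x => ?_
      rw [lintegral_fintype, lintegral_fintype, Finset.mul_sum]
      refine Finset.sum_congr rfl fun s _ => ?_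
      have hm' : Measurable fun z : Fin K × ℝ =>
          f (Fin.snoc (α := fun _ => Step M K) x (s, z)) :=
        hf.comp (measurable_snoc.comp (f := fun z : Fin K × ℝ => (x, (s, z))) (by fun_prop))
      simp only [likelihood, Fin.init_snoc, Fin.snoc_last,
        ENNReal.ofReal_mul (likelihood_pos hpos t x).le]
      rw [lintegral_const_mul _ hm', hresp, hAB]
      ring
    · exact (B.measurable_lintegral_response σ t hf).lintegral_kernel_prod_right'

/-- The gap in the inequality `log x ≤ x - 1`. -/
noncomputable def logGap (x : ℝ) : ℝ := x - 1 - Real.log x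

theorem logGap_nonneg {x : ℝ} (hx : 0 < x) : 0 ≤ logGap x := by
  have := Real.log_le_sub_one_of_pos hx
  unfold logGap; linarith

/-- If `y` has conditional mean one, the cross term averages out; this gives the chain rule for
relative entropy. -/
theorem logGap_mul {x y : ℝ} (hx : 0 < x) (hy : 0 < y) :
    logGap (x * y) = logGap x + logGap y + (x - 1) * (y - 1) := by
  unfold logGap; rw [Real.log_mul hx.ne' hy.ne']; ring

theorem measurable_logGap : Measurable logGap := by
  unfold logGap; fun_prop

/-- Applying log y ≤ y - 1 to y = √x bounds the gap below by (1 - √x)², and 1 - x = (1 - √x)(1 + √x)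
with second factor at most 2. -/
theorem sq_le_logGap {x : ℝ} (hx : 0 < x) (hx1 : x ≤ 1) : (1 - x) ^ 2 / 4 ≤ logGap x := by
  have h := Real.log_le_sub_one_of_pos (Real.sqrt_pos.2 hx)
  rw [Real.log_sqrt hx.le] at h
  have h0 := Real.sqrt_nonneg x
  have h1 : √x ≤ 1 := Real.sqrt_le_one.2 hx1
  have h2 : x = √x * √x := (Real.mul_self_sqrt hx.le).symm
  have h3 : (1 - √x) ^ 2 ≤ logGap x := by unfold logGap; linarith
  have h4 : (1 - x) ^ 2 = (1 - √x) ^ 2 * (1 + √x) ^ 2 := by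
    rw [← mul_pow, show (1 - √x) * (1 + √x) = 1 - √x * √x by ring, ← h2]
  have h5 : (1 + √x) ^ 2 ≤ 4 := by nlinarith
  nlinarith [mul_le_mul_of_nonneg_left h5 (sq_nonneg (1 - √x))]

/-- A pointwise substitute for Pinsker's inequality, by AM-GM. Being linear in the gap, it can be
summed over actions without a concavity argument. -/
theorem one_sub_le_logGap {x β : ℝ} (hx : 0 < x) (hβ : 0 < β) :
    1 ≤ x + β + logGap x / β := by
  rcases le_total x 1 with h | h
  · have h1 := sq_le_logGap hx h
    have h2 : (1 - x) ^ 2 / 4 / β ≤ logGap x / β := by gcongr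
    have h3 : 1 - x ≤ β + (1 - x) ^ 2 / 4 / β := by
      have : β + (1 - x) ^ 2 / 4 / β - (1 - x) = (2 * β - (1 - x)) ^ 2 / (4 * β) := by
        field_simp; ring
      have h4 : 0 ≤ (2 * β - (1 - x)) ^ 2 / (4 * β) := by positivity
      linarith
    linarith
  · have := logGap_nonneg hx
    have : 0 ≤ logGap x / β := by positivity
    linarith

/-- A likelihood ratio has mean one under `A`, so its mean gap is the relative entropy of `A` from
`B`; the chain rule bounds it by the sum of the stepwise costs. The nonnegative gap, unlike the
logarithm, avoids integrability questions. -/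
theorem lintegral_logGap_likelihood_le
    (hl : ∀ t, Measurable (l t).uncurry) (hpos : ∀ t x s, 0 < l t x s)
    (hAB : ∀ t x s, B.stateKernel t x {s} = ENNReal.ofReal (l t x s) * A.stateKernel t x {s})
    (k : (t : ℕ) → History M K t → ℝ≥0∞)
    (hlk : ∀ t x, ∑ s, ENNReal.ofReal (logGap (l t x s)) * A.stateKernel t x {s} ≤ k t x)
    (σ : Strategy M K) (t : ℕ) :
    ∫⁻ x, ENNReal.ofReal (logGap (likelihood l t x)) ∂A.law σ t ≤
      ∑ i ∈ Finset.range t, ∫⁻ x, k i x ∂A.law σ i := by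
  induction t with
  | zero => simp [likelihood, logGap]
  | succ t ih =>
    rw [Finset.sum_range_succ]
    have hm : Measurable fun x => ENNReal.ofReal (logGap (likelihood l t x)) :=
      (measurable_logGap.comp (measurable_likelihood hl t)).ennreal_ofReal
    refine le_trans ?_ (add_le_add_left ih _)
    rw [← lintegral_add_left hm]
    have hg : Measurable (Function.uncurry fun (x : History M K t) (s : Fin M) =>
        ENNReal.ofReal (logGap (likelihood l t x * l t x s))) :=
      (measurable_logGap.comp (((measurable_likelihood hl t).comp measurable_fst).mul
        (hl t))).ennreal_ofReal
    refine (A.lintegral_law_succ_state σ t hg).le.trans (lintegral_mono fun x => ?_)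
    refine le_trans ?_ (add_le_add_right (hlk t x) _)
    rw [lintegral_fintype]
    set w : Fin M → ℝ := fun s => (A.stateKernel t x).real {s} with hw
    have hwE : ∀ s, A.stateKernel t x {s} = ENNReal.ofReal (w s) := fun s => by
      simp [hw, Measure.real]
    have hw0 : ∀ s, 0 ≤ w s := fun s => measureReal_nonneg
    have hw1 : ∑ s, w s = 1 := by
      simp [hw]
    -- The conditional mean of the ratio is the total mass of the state kernel of `B`; this kills
    -- the cross term below.
    have hwl : ∑ s, l t x s * w s = 1 := by
      have : ∀ s, l t x s * w s = (B.stateKernel t x).real {s} := fun s => by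
        simp [hw, Measure.real, hAB, (hpos t x s).le]
      simp [this]
    simp only [hwE]
    have hL := likelihood_pos hpos t x
    simp only [← ENNReal.ofReal_mul (logGap_nonneg (hpos t x _)),
      ← ENNReal.ofReal_mul (logGap_nonneg (mul_pos hL (hpos t x _)))]
    rw [← ENNReal.ofReal_sum_of_nonneg, ← ENNReal.ofReal_sum_of_nonneg, ← ENNReal.ofReal_add]
    · refine ENNReal.ofReal_le_ofReal (le_of_eq ?_)
      have : ∀ s, logGap (likelihood l t x * l t x s) * w s =
          logGap (likelihood l t x) * w s + logGap (l t x s) * w s +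
            (likelihood l t x - 1) * (l t x s * w s - w s) := fun s => by
        rw [logGap_mul hL (hpos t x s)]; ring
      simp only [this, Finset.sum_add_distrib, ← Finset.mul_sum, Finset.sum_sub_distrib, hw1, hwl]
      ring
    · exact logGap_nonneg hL
    · exact Finset.sum_nonneg fun s _ => mul_nonneg (logGap_nonneg (hpos t x s)) (hw0 s)
    · exact fun s _ => mul_nonneg (logGap_nonneg (hpos t x s)) (hw0 s)
    · exact fun s _ => mul_nonneg (logGap_nonneg (mul_pos hL (hpos t x s))) (hw0 s)

/-- Comparison of the expectations of a `[0, 1]`-valued function under two models. -/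
theorem lintegral_law_le_add (hr : A.reward = B.reward)
    (hl : ∀ t, Measurable (l t).uncurry) (hpos : ∀ t x s, 0 < l t x s)
    (hAB : ∀ t x s, B.stateKernel t x {s} = ENNReal.ofReal (l t x s) * A.stateKernel t x {s})
    (k : (t : ℕ) → History M K t → ℝ≥0∞)
    (hlk : ∀ t x, ∑ s, ENNReal.ofReal (logGap (l t x s)) * A.stateKernel t x {s} ≤ k t x)
    (σ : Strategy M K) (t : ℕ) {f : History M K t → ℝ≥0∞} (hf : Measurable f)
    (hf1 : ∀ x, f x ≤ 1) {β : ℝ} (hβ : 0 < β) :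
    ∫⁻ x, f x ∂A.law σ t ≤ ∫⁻ x, f x ∂B.law σ t + ENNReal.ofReal β +
      ENNReal.ofReal (1 / β) * ∑ i ∈ Finset.range t, ∫⁻ x, k i x ∂A.law σ i := by
  have hm : Measurable fun x => ENNReal.ofReal (logGap (likelihood l t x)) :=
    (measurable_logGap.comp (measurable_likelihood hl t)).ennreal_ofReal
  have hmL := (measurable_likelihood hl t).ennreal_ofReal
  calc ∫⁻ x, f x ∂A.law σ t
      ≤ ∫⁻ x, (ENNReal.ofReal (likelihood l t x) * f x + ENNReal.ofReal β +
          ENNReal.ofReal (1 / β) * ENNReal.ofReal (logGap (likelihood l t x)))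
          ∂A.law σ t := by
        refine lintegral_mono fun x => ?_
        have hL := likelihood_pos hpos t x
        have h1 : (1 : ℝ≥0∞) ≤ ENNReal.ofReal (likelihood l t x) + (ENNReal.ofReal β +
            ENNReal.ofReal (1 / β) * ENNReal.ofReal (logGap (likelihood l t x))) := by
          rw [← ENNReal.ofReal_mul (by positivity), ← ENNReal.ofReal_add hβ.le
            (mul_nonneg (by positivity) (logGap_nonneg hL)), ← ENNReal.ofReal_add hL.le
            (add_nonneg hβ.le (mul_nonneg (by positivity) (logGap_nonneg hL))),
            ← ENNReal.ofReal_one]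
          refine ENNReal.ofReal_le_ofReal ?_
          have := one_sub_le_logGap hL hβ
          rw [one_div_mul_eq_div]; linarith
        calc f x = 1 * f x := (one_mul _).symm
          _ ≤ (ENNReal.ofReal (likelihood l t x) + (ENNReal.ofReal β +
            ENNReal.ofReal (1 / β) * ENNReal.ofReal (logGap (likelihood l t x)))) * f x := by
              gcongr
          _ ≤ _ := by
              rw [add_mul, add_assoc]
              gcongr
              exact mul_le_of_le_one_right' (hf1 x)
    _ = ∫⁻ x, f x ∂B.law σ t + ENNReal.ofReal β + ENNReal.ofReal (1 / β) *
          ∫⁻ x, ENNReal.ofReal (logGap (likelihood l t x)) ∂A.law σ t := by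
        rw [lintegral_add_right _ (hm.const_mul _), lintegral_add_right _ measurable_const,
          lintegral_const_mul _ hm, lintegral_const, measure_univ, mul_one,
          lintegral_law_eq_lintegral_likelihood hr hl hpos hAB σ t hf]
    _ ≤ _ := by
        gcongr
        exact lintegral_logGap_likelihood_le hl hpos hAB k hlk σ t

end Likelihood

end EpisodicRL

/-! ### The hard instances -/

namespace EpisodicRL

variable {H m K : ℕ} [NeZero H]

/-- The measure on a finite set with the given weights. -/
noncomputable def weightMeasure {ι : Type*} [Fintype ι] [MeasurableSpace ι] (w : ι → ℝ) :
    Measure ι :=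
  ∑ i, ENNReal.ofReal (w i) • Measure.dirac i

theorem weightMeasure_singleton {ι : Type*} [Fintype ι] [MeasurableSpace ι]
    [MeasurableSingletonClass ι] (w : ι → ℝ) (i : ι) :
    weightMeasure w {i} = ENNReal.ofReal (w i) := by
  classical
  simp [weightMeasure, Measure.finsetSum_apply, Set.indicator_apply, Finset.sum_ite_eq']

theorem isProbabilityMeasure_weightMeasure {ι : Type*} [Fintype ι] [MeasurableSpace ι]
    {w : ι → ℝ} (h0 : ∀ i, 0 ≤ w i) (h1 : ∑ i, w i = 1) :
    IsProbabilityMeasure (weightMeasure w) := by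
  refine ⟨?_⟩
  simp [weightMeasure, Measure.finsetSum_apply, ← ENNReal.ofReal_sum_of_nonneg fun i _ => h0 i, h1]

/-- The weights of the initial distribution of the hard instances: uniform on all states
but `0` and `1`. -/
noncomputable def initWeight (m : ℕ) (s : Fin (m + 2)) : ℝ := if s.val < 2 then 0 else 1 / m

/-- The transition weights of the hard instances: the states `0` (good) and `1` (bad) are
absorbing. The other ones are left with probability `q`, to `0` with conditional probability `p`;
otherwise the new state is uniform. -/
noncomputable def transWeight (m : ℕ) (q p : ℝ) (s s' : Fin (m + 2)) : ℝ :=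
  if s.val < 2 then (if s' = s then 1 else 0)
  else if s'.val = 0 then q * p else if s'.val = 1 then q * (1 - p) else (1 - q) / m

theorem initWeight_nonneg (s : Fin (m + 2)) : 0 ≤ initWeight m s := by
  unfold initWeight; split_ifs <;> positivity

theorem sum_initWeight (hm : 0 < m) : ∑ s, initWeight m s = 1 := by
  have : (m : ℝ) ≠ 0 := by positivity
  rw [Fin.sum_univ_succ, Fin.sum_univ_succ]
  simp [initWeight, this]

theorem transWeight_nonneg {q p : ℝ} (hq : q ∈ Set.Icc 0 1) (hp : p ∈ Set.Icc 0 1)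
    (s s' : Fin (m + 2)) : 0 ≤ transWeight m q p s s' := by
  obtain ⟨hq0, hq1⟩ := hq
  obtain ⟨hp0, hp1⟩ := hp
  have h1 : 0 ≤ 1 - p := by linarith
  have h2 : 0 ≤ 1 - q := by linarith
  unfold transWeight; split_ifs <;> positivity

theorem sum_transWeight (hm : 0 < m) (q p : ℝ) (s : Fin (m + 2)) :
    ∑ s', transWeight m q p s s' = 1 := by
  have : (m : ℝ) ≠ 0 := by positivity
  unfold transWeight
  split_ifs with h
  · simp
  · rw [Fin.sum_univ_succ, Fin.sum_univ_succ]
    simp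
    field_simp
    ring

/-- The probability of leaving the active states. -/
noncomputable def exitProb (H : ℕ) : ℝ := 1 / (2 * H)

theorem exitProb_pos : 0 < exitProb H := by
  have : 0 < H := NeZero.pos H
  unfold exitProb; positivity

theorem exitProb_mem : exitProb H ∈ Set.Icc (0 : ℝ) 1 := by
  refine ⟨exitProb_pos.le, ?_⟩
  have : (1 : ℝ) ≤ H := by exact_mod_cast NeZero.pos H
  unfold exitProb
  rw [div_le_one (by positivity)]; linarith

/-- The rewards of the hard instances. -/
noncomputable def hardReward (H m : ℕ) (h : ℕ) (s : Fin (m + 2)) : ℝ :=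
  if h + 1 = H ∧ s = 0 then 1 else 0

/-- The layer from which the `h`-th transition starts. -/
def preLayer (h : Fin (H - 1)) : Fin H := ⟨h, by omega⟩

/-- The hard instance in which leaving an active state is successful with probability `p`. -/
noncomputable def hardMDP (hm : 0 < m) (p : Fin H → Fin (m + 2) → Fin K → Set.Icc (0 : ℝ) 1) :
    LayeredMDP H (m + 2) K where
  init := weightMeasure (initWeight m)
  trans h := Kernel.ofFunOfCountable fun y =>
    weightMeasure (transWeight m (exitProb H) (p (preLayer h) y.1 y.2) y.1)
  reward h := Kernel.deterministic (fun y => hardReward H m h y.1) (measurable_of_countable _)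
  init_prob := isProbabilityMeasure_weightMeasure initWeight_nonneg (sum_initWeight hm)
  trans_markov _ := ⟨fun _ => isProbabilityMeasure_weightMeasure
    (fun s' => transWeight_nonneg exitProb_mem (p _ _ _).2 _ s') (sum_transWeight hm _ _ _)⟩
  reward_markov _ := inferInstance

section HardMDP

variable (hm : 0 < m) (p : Fin H → Fin (m + 2) → Fin K → Set.Icc (0 : ℝ) 1)

theorem stateKernel_hardMDP_of_mod_eq_zero {t : ℕ} (ht : t % H = 0)
    (x : History (m + 2) K t) :
    (hardMDP hm p).stateKernel t x = weightMeasure (initWeight m) := by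
  cases t with
  | zero => rfl
  | succ t => simp only [LayeredMDP.stateKernel, ht, dite_true, Kernel.const_apply]; rfl

theorem stateKernel_hardMDP_succ {t : ℕ} (ht : (t + 1) % H ≠ 0)
    (x : History (m + 2) K (t + 1)) :
    (hardMDP hm p).stateKernel (t + 1) x = weightMeasure (transWeight m (exitProb H)
      (p (layer H t) (x (Fin.last t)).1 (x (Fin.last t)).2.1) (x (Fin.last t)).1) := by
  -- Within an episode, the transition index computed from time t + 1 is the layer of time t.
  have hl : (t + 1) % H - 1 = t % H := by
    have hH : 0 < H := NeZero.pos H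
    have h1 := Nat.mod_lt t hH
    have h2 : (t + 1) % H = (t % H + 1) % H := by simp [Nat.add_mod]
    rcases Nat.lt_or_ge (t % H + 1) H with h | h
    · rw [h2, Nat.mod_eq_of_lt h]; omega
    · exfalso
      rw [h2, show t % H + 1 = H by omega, Nat.mod_self] at ht
      exact ht rfl
  simp only [LayeredMDP.stateKernel, ht, dite_false, Kernel.comap_apply]
  have hl' : (preLayer ⟨(t + 1) % H - 1, by
        have := Nat.mod_lt (t + 1) (NeZero.pos H); omega⟩ : Fin H) = layer H t :=
    Fin.ext hl
  rw [← hl']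
  rfl

/-- The action affects only the split between the two absorbing states, so no history can steer
towards a chosen active state. -/
theorem stateKernel_hardMDP_active_le (t : ℕ) (x : History (m + 2) K t) (i : Fin m) :
    (hardMDP hm p).stateKernel t x {i.succ.succ} ≤ ENNReal.ofReal (1 / m) := by
  by_cases ht : t % H = 0
  · rw [stateKernel_hardMDP_of_mod_eq_zero hm p ht, weightMeasure_singleton]
    simp [initWeight]
  · obtain _ | t := t
    · simp at ht
    rw [stateKernel_hardMDP_succ hm p ht, weightMeasure_singleton]
    refine ENNReal.ofReal_le_ofReal ?_
    have hq := (exitProb_mem (H := H)).1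
    unfold transWeight
    split_ifs with h1 h2 h3 h4
    · rw [← h2] at h1; simp at h1
    · positivity
    · simp at h3
    · simp at h4
    · gcongr; linarith

/-- Each active state is visited with probability at most `1 / m` at any time. -/
theorem law_hardMDP_active_le (σ : Strategy (m + 2) K) (t : ℕ) (i : Fin m) :
    (hardMDP hm p).law σ (t + 1) {x | (x (Fin.last t)).1 = i.succ.succ} ≤
      ENNReal.ofReal (1 / m) := by
  have hms : MeasurableSet {x : History (m + 2) K (t + 1) | (x (Fin.last t)).1 = i.succ.succ} :=
    measurableSet_eq_fun (by fun_prop) measurable_const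
  have hg : Measurable (Function.uncurry fun (_ : History (m + 2) K t) (s : Fin (m + 2)) =>
      Set.indicator {i.succ.succ} (1 : Fin (m + 2) → ℝ≥0∞) s) :=
    (measurable_of_countable _).comp measurable_snd
  have := (hardMDP hm p).lintegral_law_succ_state σ t hg
  rw [← lintegral_indicator_one hms]
  refine (le_of_eq ?_).trans (this.le.trans ?_)
  · exact lintegral_congr fun x => by simp [Set.indicator_apply]
  · refine (lintegral_mono fun x => ?_).trans_eq
      ((lintegral_const (ENNReal.ofReal (1 / m))).trans (by simp))
    rw [lintegral_indicator_one (measurableSet_singleton _)]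
    exact stateKernel_hardMDP_active_le hm p t x i

theorem ae_reward_hardMDP (σ : Strategy (m + 2) K) (t : ℕ) :
    ∀ᵐ x ∂(hardMDP hm p).law σ t,
      ∀ i : Fin t, (x i).2.2 = hardReward H m (layer H i) (x i).1 := by
  have hms : ∀ t, MeasurableSet {x : History (m + 2) K t |
      ∀ i : Fin t, (x i).2.2 = hardReward H m (layer H i) (x i).1} := fun t => by
    rw [Set.ofPred_forall]
    refine MeasurableSet.iInter fun i => measurableSet_eq_fun (by fun_prop) ?_
    exact (measurable_of_countable (hardReward H m (layer H i))).comp (by fun_prop)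
  induction t with
  | zero => exact Filter.Eventually.of_forall fun x i => i.elim0
  | succ t ih =>
    have hmc := (hms (t + 1)).compl
    rw [ae_iff, ← Set.compl_ofPred, ← lintegral_indicator_one hmc,
      LayeredMDP.lintegral_law_succ _ _ _ (measurable_one.indicator hmc)]
    rw [lintegral_eq_zero_of_ae_eq_zero]
    filter_upwards [ih] with x hx
    simp only [Pi.zero_apply]
    rw [lintegral_eq_zero_of_ae_eq_zero]
    refine Filter.Eventually.of_forall fun s => ?_
    simp only [Pi.zero_apply]
    rw [LayeredMDP.responseKernel, Kernel.lintegral_compProd]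
    · rw [lintegral_eq_zero_of_ae_eq_zero]
      refine Filter.Eventually.of_forall fun a => ?_
      have : (((hardMDP hm p).reward (layer H t)).comap
          (fun y : (History (m + 2) K t × Fin (m + 2)) × Fin K => (y.1.2, y.2)) (by fun_prop))
          ((x, s), a) = Measure.dirac (hardReward H m (layer H t) s) := by
        simp [Kernel.comap_apply, hardMDP, Kernel.deterministic_apply]
      simp only [Pi.zero_apply]
      rw [this, lintegral_dirac', Set.indicator_of_notMem]
      · simp only [Set.mem_compl_iff, not_not, Set.mem_ofPred_eq]
        refine Fin.lastCases ?_ fun i => ?_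
        · simp
        · simpa using hx i
      · exact (measurable_one.indicator hmc).comp (measurable_snoc.comp
          (f := fun r : ℝ => (x, (s, (a, r)))) (by fun_prop))
    · exact (measurable_one.indicator hmc).comp (measurable_snoc.comp
        (f := fun z : Fin K × ℝ => (x, (s, z))) (by fun_prop))

end HardMDP

end EpisodicRL

/-! ### The value of a policy in a hard instance -/

namespace EpisodicRL

variable {H m K N : ℕ} [NeZero H]

/-- The distribution of the state at time `t`. -/
noncomputable def LayeredMDP.stateLaw {M : ℕ} (mdp : LayeredMDP H M K) (σ : Strategy M K) (t : ℕ) :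
    Measure (Fin M) :=
  (mdp.law σ t).bind (mdp.stateKernel t)

theorem LayeredMDP.law_state_eq {M : ℕ} (mdp : LayeredMDP H M K) (σ : Strategy M K) (t : ℕ)
    (s : Fin M) :
    mdp.law σ (t + 1) {x | (x (Fin.last t)).1 = s} = mdp.stateLaw σ t {s} := by
  have hms : MeasurableSet {x : History M K (t + 1) | (x (Fin.last t)).1 = s} :=
    measurableSet_eq_fun (by fun_prop) measurable_const
  have hg : Measurable (Function.uncurry fun (_ : History M K t) (s' : Fin M) =>
      Set.indicator {s} (1 : Fin M → ℝ≥0∞) s') :=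
    (measurable_of_countable _).comp measurable_snd
  have := mdp.lintegral_law_succ_state σ t hg
  rw [← lintegral_indicator_one hms, stateLaw,
    Measure.bind_apply (measurableSet_singleton _) (Kernel.aemeasurable _)]
  refine Eq.trans ?_ (this.trans ?_)
  · exact lintegral_congr fun x => by simp [Set.indicator_apply]
  · refine lintegral_congr fun x => ?_
    rw [lintegral_indicator_one (measurableSet_singleton _)]

section

variable (hm : 0 < m)

theorem sum_reward_of_eq (hH : H = N + 1) (x : History (m + 2) K H)
    (hx : ∀ i : Fin H, (x i).2.2 = hardReward H m (layer H i) (x i).1) :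
    ∑ i, (x i).2.2 = if (x (Fin.cast hH.symm (Fin.last N))).1 = 0 then 1 else 0 := by
  subst hH
  simp only [hx]
  rw [Fin.sum_univ_castSucc, Finset.sum_eq_zero, zero_add]
  · simp [hardReward, layer]
  · intro i _
    have : i.val % (N + 1) ≠ N := by
      rw [Nat.mod_eq_of_lt (by omega)]; omega
    simp [hardReward, layer, this]

theorem boundedRewards_hardMDP (p : Fin H → Fin (m + 2) → Fin K → Set.Icc (0 : ℝ) 1) :
    (hardMDP hm p).BoundedRewards := by
  intro σ
  obtain ⟨N, hN⟩ := Nat.exists_eq_succ_of_ne_zero (NeZero.ne H)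
  filter_upwards [ae_reward_hardMDP hm p σ H] with x hx
  refine ⟨fun i => ?_, ?_⟩
  · rw [hx]; unfold hardReward; split_ifs <;> norm_num
  · rw [sum_reward_of_eq hN x hx]; split_ifs <;> norm_num

variable (p : Fin H → Fin (m + 2) → Fin K → Set.Icc (0 : ℝ) 1)

theorem value_hardMDP_eq (hH : H = N + 1) (π : Policy H (m + 2) K) :
    (hardMDP hm p).value π = ((hardMDP hm p).stateLaw π.toStrategy N).real {0} := by
  have h1 : (hardMDP hm p).value π =
      ∫ x, (if (x (Fin.cast hH.symm (Fin.last N))).1 = 0 then (1 : ℝ) else 0)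
        ∂(hardMDP hm p).law π.toStrategy H := by
    refine integral_congr_ae ?_
    filter_upwards [ae_reward_hardMDP hm p π.toStrategy H] with x hx
    exact sum_reward_of_eq hH x hx
  rw [h1, Measure.real, ← LayeredMDP.law_state_eq]
  subst hH
  have hms : MeasurableSet {x : History (m + 2) K (N + 1) | (x (Fin.last N)).1 = 0} :=
    measurableSet_eq_fun (by fun_prop) measurable_const
  rw [← Measure.real, ← integral_indicator_one hms]
  refine integral_congr_ae (Filter.Eventually.of_forall fun x => ?_)
  simp [Set.indicator_apply]

theorem stateLaw_hardMDP_zero (σ : Strategy (m + 2) K) (s : Fin (m + 2)) :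
    ((hardMDP hm p).stateLaw σ 0).real {s} = initWeight m s := by
  rw [Measure.real, LayeredMDP.stateLaw,
    Measure.bind_apply (measurableSet_singleton _) (Kernel.aemeasurable _)]
  simp only [stateKernel_hardMDP_of_mod_eq_zero hm p (Nat.zero_mod H), weightMeasure_singleton]
  simp [initWeight_nonneg]

theorem stateLaw_hardMDP_succ (π : Policy H (m + 2) K) {t : ℕ} (ht : (t + 1) % H ≠ 0)
    (s' : Fin (m + 2)) :
    ((hardMDP hm p).stateLaw π.toStrategy (t + 1)).real {s'} =
      ∑ s, ((hardMDP hm p).stateLaw π.toStrategy t).real {s} *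
        transWeight m (exitProb H) (p (layer H t) s (π (layer H t) s)) s s' := by
  have hnn : ∀ s a, 0 ≤ transWeight m (exitProb H) (p (layer H t) s a) s s' := fun s a =>
    transWeight_nonneg exitProb_mem (p _ _ _).2 _ _
  set W : Fin (m + 2) → Fin K → ℝ≥0∞ := fun s a =>
    ENNReal.ofReal (transWeight m (exitProb H) (p (layer H t) s a) s s') with hW
  have hWm : Measurable (Function.uncurry W) := measurable_of_countable _
  have key : (hardMDP hm p).stateLaw π.toStrategy (t + 1) {s'} =
      ∑ s, W s (π (layer H t) s) * (hardMDP hm p).stateLaw π.toStrategy t {s} := by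
    rw [LayeredMDP.stateLaw,
      Measure.bind_apply (measurableSet_singleton _) (Kernel.aemeasurable _)]
    have h1 : ∀ x : History (m + 2) K (t + 1), (hardMDP hm p).stateKernel (t + 1) x {s'} =
        W (x (Fin.last t)).1 (x (Fin.last t)).2.1 := fun x => by
      rw [stateKernel_hardMDP_succ hm p ht, weightMeasure_singleton]
    simp only [h1]
    rw [LayeredMDP.lintegral_law_succ]
    · simp only [Fin.snoc_last]
      rw [← lintegral_fintype, LayeredMDP.stateLaw,
        Measure.lintegral_bind (Kernel.aemeasurable _) (measurable_of_countable _).aemeasurable]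
      refine lintegral_congr fun x => lintegral_congr fun s => ?_
      rw [LayeredMDP.responseKernel, Kernel.lintegral_compProd]
      · simp [Policy.toStrategy, Kernel.deterministic_apply]
      · exact hWm.comp (f := fun z : Fin K × ℝ => (s, z.1)) (by fun_prop)
    · exact hWm.comp (f := fun x : History (m + 2) K (t + 1) =>
        ((x (Fin.last t)).1, (x (Fin.last t)).2.1)) (by fun_prop)
  rw [Measure.real, key, ENNReal.toReal_sum]
  · refine Finset.sum_congr rfl fun s _ => ?_
    rw [ENNReal.toReal_mul, ENNReal.toReal_ofReal (hnn _ _), mul_comm]; rfl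
  · intro s _
    refine ENNReal.mul_ne_top ENNReal.ofReal_ne_top ?_
    rw [← LayeredMDP.law_state_eq]
    exact measure_ne_top _ _

theorem add_one_mod_ne_zero {H t : ℕ} (ht : t + 1 < H) : (t + 1) % H ≠ 0 := by
  rw [Nat.mod_eq_of_lt ht]; omega

/-- Absorbing states never return mass, and the surviving mass is redistributed uniformly whatever
the action. -/
theorem stateLaw_hardMDP_active (π : Policy H (m + 2) K) {t : ℕ} (ht : t < H) (i : Fin m) :
    ((hardMDP hm p).stateLaw π.toStrategy t).real {i.succ.succ} = (1 - exitProb H) ^ t / m := by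
  have hm0 : (m : ℝ) ≠ 0 := by positivity
  induction t generalizing i with
  | zero => rw [stateLaw_hardMDP_zero]; simp [initWeight]
  | succ t ih =>
    rw [stateLaw_hardMDP_succ hm p π (add_one_mod_ne_zero ht), Fin.sum_univ_succ,
      Fin.sum_univ_succ]
    simp only [ih (by omega)]
    have h0 : ∀ p, transWeight m (exitProb H) p 0 i.succ.succ = 0 := fun p => by
      simp [transWeight]
    have h1 : ∀ p, transWeight m (exitProb H) p (Fin.succ 0) i.succ.succ = 0 := fun p => by
      have : i.succ.succ ≠ Fin.succ 0 := (Fin.succ_injective _).ne (Fin.succ_ne_zero i)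
      rw [transWeight, if_pos (by simp), if_neg this]
    have h2 : ∀ (p : ℝ) (j : Fin m), transWeight m (exitProb H) p j.succ.succ i.succ.succ =
        (1 - exitProb H) / m := fun p j => by
      simp [transWeight]
    simp only [h0, h1, h2, Finset.sum_const, Finset.card_univ, Fintype.card_fin, nsmul_eq_mul]
    field_simp
    ring

theorem stateLaw_hardMDP_good (π : Policy H (m + 2) K) {t : ℕ} (ht : t < H) :
    ((hardMDP hm p).stateLaw π.toStrategy t).real {0} =
      ∑ j ∈ Finset.range t, ∑ i : Fin m, (1 - exitProb H) ^ j / m *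
        (exitProb H * p (layer H j) i.succ.succ (π (layer H j) i.succ.succ)) := by
  induction t with
  | zero => rw [stateLaw_hardMDP_zero]; simp [initWeight]
  | succ t ih =>
    rw [stateLaw_hardMDP_succ hm p π (add_one_mod_ne_zero ht), Fin.sum_univ_succ,
      Fin.sum_univ_succ, Finset.sum_range_succ, ← ih (by omega)]
    simp only [stateLaw_hardMDP_active hm p π (by omega : t < H)]
    simp [transWeight]

/-- The value is the mass absorbed in the good state before the last layer. It is additive over
layers and states, so choices in different states do not interact; actions in the last layer are
irrelevant. -/
theorem value_hardMDP (π : Policy H (m + 2) K) :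
    (hardMDP hm p).value π = ∑ j ∈ Finset.range (H - 1), ∑ i : Fin m,
      (1 - exitProb H) ^ j / m *
        (exitProb H * p (layer H j) i.succ.succ (π (layer H j) i.succ.succ)) := by
  obtain ⟨N, hN⟩ := Nat.exists_eq_succ_of_ne_zero (NeZero.ne H)
  rw [value_hardMDP_eq hm p hN π, stateLaw_hardMDP_good hm p π (by omega),
    show H - 1 = N by omega]

end

/-- A lower bound on the probability of leaving a given active state at time `j`. -/
theorem exit_weight_ge {j : ℕ} (hj : j < H) (hm : 0 < m) :
    1 / (4 * H * m) ≤ (1 - exitProb H) ^ j / m * exitProb H := by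
  have hH : (0 : ℝ) < H := by exact_mod_cast NeZero.pos H
  have hj' : (j : ℝ) ≤ H := by exact_mod_cast hj.le
  -- Bernoulli's inequality: as the exit probability is 1/(2H), at least half of the mass is still
  -- active in every layer.
  have h1 : 1 + (j : ℝ) * (-exitProb H) ≤ (1 + -exitProb H) ^ j :=
    one_add_mul_le_pow (by linarith [(exitProb_mem (H := H)).2]) j
  have h2 : (j : ℝ) * exitProb H ≤ 1 / 2 := by
    unfold exitProb
    rw [mul_one_div, div_le_div_iff₀ (by positivity) (by positivity)]; linarith
  have h3 : (1 : ℝ) / 2 ≤ (1 - exitProb H) ^ j := by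
    rw [sub_eq_add_neg]; linarith
  calc (1 : ℝ) / (4 * H * m) = 1 / 2 / m * exitProb H := by
        unfold exitProb; field_simp; norm_num
    _ ≤ _ := by
        have := (exitProb_mem (H := H)).1
        gcongr

end EpisodicRL

/-! ### Information gained about one action in one state -/

namespace EpisodicRL

variable {H m K n : ℕ} [NeZero H]

/-- The likelihood ratio of the new state between success probabilities `1 / 2 + δ` and `1 / 2`. -/
noncomputable def exitRatio (δ : ℝ) (s : Fin (m + 2)) : ℝ :=
  if s.val = 0 then 1 + 2 * δ else if s.val = 1 then 1 - 2 * δ else 1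

theorem exitRatio_pos {δ : ℝ} (h0 : 0 ≤ δ) (h1 : δ ≤ 1 / 4) (s : Fin (m + 2)) :
    0 < exitRatio δ s := by
  unfold exitRatio; split_ifs <;> linarith

theorem transWeight_half_add (q δ : ℝ) (i : Fin m) (s : Fin (m + 2)) :
    transWeight m q (1 / 2 + δ) i.succ.succ s =
      exitRatio δ s * transWeight m q (1 / 2) i.succ.succ s := by
  have hi : ¬ i.succ.succ.val < 2 := by simp
  simp only [exitRatio, transWeight, if_neg hi]
  split_ifs <;> ring

theorem sum_logGap_exitRatio_le {q δ : ℝ} (hq : 0 ≤ q) (h0 : 0 ≤ δ) (h1 : δ ≤ 1 / 4) (i : Fin m) :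
    ∑ s, logGap (exitRatio δ s) * transWeight m q (1 / 2) i.succ.succ s ≤ 4 * q * δ ^ 2 := by
  have e : ∑ s, logGap (exitRatio δ s) * transWeight m q (1 / 2) i.succ.succ s =
      q / 2 * (logGap (1 + 2 * δ) + logGap (1 - 2 * δ)) := by
    rw [Fin.sum_univ_succ, Fin.sum_univ_succ]
    simp [exitRatio, transWeight, show logGap 1 = 0 by simp [logGap]]
    ring
  -- The first-order terms in δ cancel between the two outcomes, leaving a cost of order δ².
  have hlog : logGap (1 + 2 * δ) + logGap (1 - 2 * δ) = -Real.log (1 - 4 * δ ^ 2) := by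
    rw [show 1 - 4 * δ ^ 2 = (1 + 2 * δ) * (1 - 2 * δ) by ring,
      Real.log_mul (by linarith) (by linarith)]
    unfold logGap; ring
  have hδ : δ ^ 2 ≤ 1 / 16 := by nlinarith
  have h2 := Real.one_sub_inv_le_log_of_pos (show 0 < 1 - 4 * δ ^ 2 by linarith)
  have h3 : (1 - 4 * δ ^ 2)⁻¹ ≤ 1 + 8 * δ ^ 2 := by
    rw [inv_le_iff_one_le_mul₀ (by linarith)]
    nlinarith [sq_nonneg δ, mul_nonneg (sq_nonneg δ) (by linarith : 0 ≤ 1 / 16 - δ ^ 2)]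
  rw [e, hlog]
  have : -Real.log (1 - 4 * δ ^ 2) ≤ 8 * δ ^ 2 := by linarith
  calc q / 2 * -Real.log (1 - 4 * δ ^ 2) ≤ q / 2 * (8 * δ ^ 2) := by gcongr
    _ = _ := by ring

/-- The likelihood ratio of the new state if only the success probability of the action `a` in the
state `s` of layer `h` is changed. -/
noncomputable def stateRatio (δ : ℝ) (h : Fin H) (s : Fin (m + 2)) (a : Fin K) :
    (t : ℕ) → History (m + 2) K t → Fin (m + 2) → ℝ
  | 0, _, _ => 1
  | t + 1, x, s' =>
    -- After the last layer a new episode begins, whose initial state carries no information.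
    -- `visitCost` omits this case distinction, being needed only as an upper bound.
    if ((t + 1) % H ≠ 0 ∧ layer H t = h) ∧ (x (Fin.last t)).1 = s ∧ (x (Fin.last t)).2.1 = a then
      exitRatio δ s' else 1

/-- The cost `c` if the previous step was the action `a` in the state `s` of layer `h`. -/
noncomputable def visitCost (c : ℝ≥0∞) (h : Fin H) (s : Fin (m + 2)) (a : Fin K) :
    (t : ℕ) → History (m + 2) K t → ℝ≥0∞
  | 0, _ => 0
  | t + 1, x =>
    if layer H t = h ∧ (x (Fin.last t)).1 = s ∧ (x (Fin.last t)).2.1 = a then c else 0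

theorem measurable_stateRatio (δ : ℝ) (h : Fin H) (s : Fin (m + 2)) (a : Fin K) (t : ℕ) :
    Measurable (stateRatio δ h s a t).uncurry := by
  cases t with
  | zero => exact measurable_const
  | succ t =>
    let F : Fin (m + 2) × Fin K × Fin (m + 2) → ℝ := fun y =>
      if ((t + 1) % H ≠ 0 ∧ layer H t = h) ∧ y.1 = s ∧ y.2.1 = a then exitRatio δ y.2.2 else 1
    exact (measurable_of_countable F).comp
      (f := fun p : History (m + 2) K (t + 1) × Fin (m + 2) =>
        ((p.1 (Fin.last t)).1, (p.1 (Fin.last t)).2.1, p.2)) (by fun_prop)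

theorem stateRatio_pos {δ : ℝ} (h0 : 0 ≤ δ) (h1 : δ ≤ 1 / 4) (h : Fin H) (s : Fin (m + 2))
    (a : Fin K) (t : ℕ) (x : History (m + 2) K t) (s' : Fin (m + 2)) :
    0 < stateRatio δ h s a t x s' := by
  cases t with
  | zero => exact one_pos
  | succ t =>
    rw [stateRatio]
    split_ifs
    exacts [exitRatio_pos h0 h1 _, one_pos]

section Compare

variable (hm : 0 < m) {p p' : Fin H → Fin (m + 2) → Fin K → Set.Icc (0 : ℝ) 1}
  {δ : ℝ} {h : Fin H} {i : Fin m} {a : Fin K}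

theorem stateKernel_eq_stateRatio_mul (h0 : 0 ≤ δ) (h1 : δ ≤ 1 / 4)
    (hp : (p h i.succ.succ a : ℝ) = 1 / 2) (hp' : (p' h i.succ.succ a : ℝ) = 1 / 2 + δ)
    (hpp : ∀ h' s' a', ¬ (h' = h ∧ s' = i.succ.succ ∧ a' = a) → p' h' s' a' = p h' s' a')
    (t : ℕ) (x : History (m + 2) K t) (s : Fin (m + 2)) :
    (hardMDP hm p').stateKernel t x {s} =
      ENNReal.ofReal (stateRatio δ h i.succ.succ a t x s) *
        (hardMDP hm p).stateKernel t x {s} := by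
  by_cases ht : t % H = 0
  · rw [stateKernel_hardMDP_of_mod_eq_zero hm p ht, stateKernel_hardMDP_of_mod_eq_zero hm p' ht]
    cases t with
    | zero => simp [stateRatio]
    | succ t => simp [stateRatio, ht]
  · obtain _ | t := t
    · simp at ht
    rw [stateKernel_hardMDP_succ hm p ht, stateKernel_hardMDP_succ hm p' ht,
      weightMeasure_singleton, weightMeasure_singleton]
    by_cases hv : layer H t = h ∧ (x (Fin.last t)).1 = i.succ.succ ∧ (x (Fin.last t)).2.1 = a
    · rw [stateRatio, if_pos ⟨⟨ht, hv.1⟩, hv.2⟩, hv.1, hv.2.1, hv.2.2, hp, hp',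
        transWeight_half_add, ENNReal.ofReal_mul (exitRatio_pos h0 h1 s).le]
    · rw [stateRatio, if_neg (by tauto), hpp _ _ _ hv]
      simp

theorem sum_logGap_stateRatio_le (h0 : 0 ≤ δ) (h1 : δ ≤ 1 / 4)
    (hp : (p h i.succ.succ a : ℝ) = 1 / 2) (t : ℕ) (x : History (m + 2) K t) :
    ∑ s, ENNReal.ofReal (logGap (stateRatio δ h i.succ.succ a t x s)) *
        (hardMDP hm p).stateKernel t x {s} ≤
      visitCost (ENNReal.ofReal (4 * exitProb H * δ ^ 2)) h i.succ.succ a t x := by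
  have hlog1 : logGap 1 = 0 := by simp [logGap]
  cases t with
  | zero => simp [stateRatio, visitCost, hlog1]
  | succ t =>
    by_cases hv : ((t + 1) % H ≠ 0 ∧ layer H t = h) ∧
        (x (Fin.last t)).1 = i.succ.succ ∧ (x (Fin.last t)).2.1 = a
    · simp only [stateRatio, visitCost, stateKernel_hardMDP_succ hm p hv.1.1,
        weightMeasure_singleton, hv.1.2, hv.2, hp]
      simp only [ne_eq, hv.1.1, not_false_eq_true, and_self, if_true]
      have hnn : ∀ s : Fin (m + 2), 0 ≤ logGap (exitRatio δ s) := fun s =>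
        logGap_nonneg (exitRatio_pos h0 h1 s)
      have hnn' : ∀ s : Fin (m + 2), 0 ≤ transWeight m (exitProb H) (1 / 2) i.succ.succ s :=
        fun s => transWeight_nonneg exitProb_mem (by norm_num) _ _
      simp only [← ENNReal.ofReal_mul (hnn _)]
      rw [← ENNReal.ofReal_sum_of_nonneg fun s _ => mul_nonneg (hnn s) (hnn' s)]
      exact ENNReal.ofReal_le_ofReal (sum_logGap_exitRatio_le exitProb_mem.1 h0 h1 i)
    · simp only [stateRatio, if_neg hv, hlog1]
      simp

theorem sum_range_layer_eq (h : Fin H) (c : ℝ≥0∞) (n : ℕ) :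
    ∑ t ∈ Finset.range (n * H), (if layer H t = h then c else 0) = n * c := by
  induction n with
  | zero => simp
  | succ n ih =>
    rw [Nat.succ_mul, Finset.sum_range_add, ih, Finset.sum_range]
    have : ∀ j : Fin H, layer H (n * H + j) = j := fun j => Fin.ext <| by
      simp [layer, Nat.add_mod, Nat.mod_eq_of_lt j.2]
    simp only [this]
    simp [add_mul]

/-- The total cost of all visits of a state in `n` episodes. -/
theorem sum_visitCost_le (c : ℝ≥0∞) (σ : Strategy (m + 2) K) (n : ℕ) :
    ∑ a, ∑ t ∈ Finset.range (n * H), ∫⁻ x, visitCost c h i.succ.succ a t x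
      ∂(hardMDP hm p).law σ t ≤ n * (c * ENNReal.ofReal (1 / m)) := by
  have hmeas : ∀ a t, Measurable (visitCost c h i.succ.succ (a : Fin K) t) := fun a t => by
    cases t with
    | zero => exact measurable_const
    | succ t =>
      let F : Fin (m + 2) × Fin K → ℝ≥0∞ := fun y =>
        if layer H t = h ∧ y.1 = i.succ.succ ∧ y.2 = a then c else 0
      exact (measurable_of_countable F).comp
        (f := fun x : History (m + 2) K (t + 1) =>
          ((x (Fin.last t)).1, (x (Fin.last t)).2.1)) (by fun_prop)
  rw [Finset.sum_comm, ← sum_range_layer_eq h]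
  -- The cost at time t + 1 refers to step t: one more time is added so that, after dropping the
  -- zero cost at time 0, the sum runs over all nH steps.
  calc _ ≤ ∑ t ∈ Finset.range (n * H + 1), ∑ a, ∫⁻ x, visitCost c h i.succ.succ a t x
            ∂(hardMDP hm p).law σ t :=
        Finset.sum_le_sum_of_subset (Finset.range_mono (Nat.le_succ _))
    _ ≤ _ := by
        rw [Finset.sum_range_succ']
        have hz : ∀ (a : Fin K) (x : History (m + 2) K 0),
            visitCost c h i.succ.succ a 0 x = 0 := fun _ _ => rfl
        simp only [hz, lintegral_const, zero_mul, Finset.sum_const_zero, add_zero]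
        refine Finset.sum_le_sum fun t _ => ?_
        rw [← lintegral_finsetSum _ fun a _ => hmeas a (t + 1)]
        simp only [visitCost]
        split_ifs with ht
        · simp only [ht, true_and]
          have hms : MeasurableSet {x : History (m + 2) K (t + 1) |
              (x (Fin.last t)).1 = i.succ.succ} :=
            measurableSet_eq_fun (by fun_prop) measurable_const
          calc _ = ∫⁻ x, c * Set.indicator {x : History (m + 2) K (t + 1) |
                (x (Fin.last t)).1 = i.succ.succ} 1 x ∂(hardMDP hm p).law σ (t + 1) := by
                refine lintegral_congr fun x => ?_
                by_cases hx : (x (Fin.last t)).1 = i.succ.succ <;> simp [hx]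
            _ ≤ _ := by
                rw [lintegral_const_mul _ (measurable_one.indicator hms),
                  lintegral_indicator_one hms]
                gcongr
                exact law_hardMDP_active_le hm p σ t i
        · simp [ht]

theorem outputLaw_apply {M : ℕ} (alg : Algorithm H M K n) (mdp : LayeredMDP H M K)
    (B : Set (Policy H M K)) :
    alg.outputLaw mdp B = ∫⁻ x, alg.output x B ∂mdp.law alg.toStrategy (n * H) :=
  Measure.bind_apply (Set.toFinite B).measurableSet (Kernel.aemeasurable _)

/-- The cost is measured under the neutral model `p`, which can be the same for every `a`; the costs
of all actions therefore add up to a bound on the visits of one state. -/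
theorem outputLaw_le_add (alg : Algorithm H (m + 2) K n) (h0 : 0 ≤ δ) (h1 : δ ≤ 1 / 4)
    (hp : (p h i.succ.succ a : ℝ) = 1 / 2) (hp' : (p' h i.succ.succ a : ℝ) = 1 / 2 + δ)
    (hpp : ∀ h' s' a', ¬ (h' = h ∧ s' = i.succ.succ ∧ a' = a) → p' h' s' a' = p h' s' a')
    {β : ℝ} (hβ : 0 < β) (B : Set (Policy H (m + 2) K)) :
    alg.outputLaw (hardMDP hm p) B ≤ alg.outputLaw (hardMDP hm p') B + ENNReal.ofReal β +
      ENNReal.ofReal (1 / β) * ∑ t ∈ Finset.range (n * H),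
        ∫⁻ x, visitCost (ENNReal.ofReal (4 * exitProb H * δ ^ 2)) h i.succ.succ a t x
          ∂(hardMDP hm p).law alg.toStrategy t := by
  have := alg.output_markov
  rw [outputLaw_apply, outputLaw_apply]
  exact lintegral_law_le_add (A := hardMDP hm p) (B := hardMDP hm p') rfl (measurable_stateRatio δ h i.succ.succ a)
    (stateRatio_pos h0 h1 h i.succ.succ a) (stateKernel_eq_stateRatio_mul hm h0 h1 hp hp' hpp) _
    (sum_logGap_stateRatio_le hm h0 h1 hp) _ _
    (Kernel.measurable_coe _ (Set.toFinite B).measurableSet) (fun _ => prob_le_one) hβ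

end Compare

end EpisodicRL

/-! ### Averaging over the hidden policy -/

namespace EpisodicRL

variable {H m K n : ℕ} [NeZero H]

/-- The success probabilities for which `θ` is the optimal policy. -/
noncomputable def hiddenProb (θ : Policy H (m + 2) K) (δ : Set.Icc (0 : ℝ) (1 / 4)) (h : Fin H)
    (s : Fin (m + 2)) (a : Fin K) : Set.Icc (0 : ℝ) 1 :=
  if a = θ h s then ⟨1 / 2 + δ, by have := δ.2.1; have := δ.2.2; constructor <;> linarith⟩
  else ⟨1 / 2, by norm_num⟩

/-- `hiddenProb` with the optimal action in one state replaced by a neutral one. -/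
noncomputable def erasedProb (θ : Policy H (m + 2) K) (δ : Set.Icc (0 : ℝ) (1 / 4)) (h₀ : Fin H)
    (s₀ : Fin (m + 2)) (h : Fin H) (s : Fin (m + 2)) (a : Fin K) : Set.Icc (0 : ℝ) 1 :=
  if h = h₀ ∧ s = s₀ then ⟨1 / 2, by norm_num⟩ else hiddenProb θ δ h s a

/-- The policy `θ` with the action in one state changed. -/
def Policy.update {M : ℕ} (θ : Policy H M K) (h : Fin H) (s : Fin M) (a : Fin K) : Policy H M K :=
  Function.update θ h (Function.update (θ h) s a)

theorem Policy.update_same {H M : ℕ} (θ : Policy H M K) (h : Fin H) (s : Fin M) (a : Fin K) :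
    θ.update h s a h s = a := by simp [Policy.update]

theorem Policy.update_of_ne {H M : ℕ} (θ : Policy H M K) {h h' : Fin H} {s s' : Fin M} (a : Fin K)
    (hne : ¬ (h' = h ∧ s' = s)) : θ.update h s a h' s' = θ h' s' := by
  unfold Policy.update
  by_cases hh : h' = h
  · subst hh
    have : s' ≠ s := fun hs => hne ⟨rfl, hs⟩
    simp [this]
  · simp [hh]

theorem Policy.update_update {H M : ℕ} (θ : Policy H M K) (h : Fin H) (s : Fin M) (a b : Fin K) :
    (θ.update h s a).update h s b = θ.update h s b := by
  simp [Policy.update]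

theorem Policy.update_eq_self {H M : ℕ} (θ : Policy H M K) (h : Fin H) (s : Fin M) :
    θ.update h s (θ h s) = θ := by
  simp [Policy.update]

/-- Resampling one action of a uniformly distributed policy. -/
theorem sum_sum_update {H M : ℕ} (F : Policy H M K → ℝ) (h : Fin H) (s : Fin M) :
    ∑ θ : Policy H M K, ∑ a, F (θ.update h s a) = K * ∑ θ, F θ := by
  have h1 : ∑ y : Policy H M K × Fin K, F (y.1.update h s y.2) =
      ∑ y : Policy H M K × Fin K, F y.1 := by
    -- Exchanging the prescribed action with the spare one is an involution.
    refine Finset.sum_nbij' (fun y => (y.1.update h s y.2, y.1 h s))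
      (fun y => (y.1.update h s y.2, y.1 h s)) ?_ ?_ ?_ ?_ ?_ <;>
      simp [Policy.update_update, Policy.update_same, Policy.update_eq_self]
  rw [Fintype.sum_prod_type, Fintype.sum_prod_type] at h1
  rw [h1]
  simp [Finset.mul_sum]

section

variable (hm : 0 < m) (δ : Set.Icc (0 : ℝ) (1 / 4)) (alg : Algorithm H (m + 2) K n)

theorem sum_prob_ne {H M : ℕ} (P : Measure (Policy H M K)) [IsProbabilityMeasure P] (h : Fin H)
    (s : Fin M) : ∑ a, P.real {π | π h s ≠ a} = K - 1 := by
  have h1 : ∀ a, P.real {π | π h s ≠ a} = 1 - P.real ((fun π : Policy H M K => π h s) ⁻¹' {a}) :=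
    fun a => probReal_compl_eq_one_sub (s := (fun π : Policy H M K => π h s) ⁻¹' {a})
      (Set.toFinite _).measurableSet
  simp only [h1, Finset.sum_sub_distrib]
  rw [sum_measureReal_preimage_singleton _ fun _ _ => (Set.toFinite _).measurableSet]
  simp

/-- Erasing the entry of θ at this state gives one reference model for all K candidates. Under it
the output misses exactly K - 1 of the candidate actions, and passing to the true models costs β
each plus the shared information. -/
theorem sum_prob_ne_update_ge (θ : Policy H (m + 2) K) (h : Fin H) (i : Fin m) {β : ℝ}
    (hβ : 0 < β) :
    (K : ℝ) - 1 ≤ ∑ a, (alg.outputLaw (hardMDP hm (hiddenProb (θ.update h i.succ.succ a) δ))).real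
        {π | π h i.succ.succ ≠ a} + K * β +
      1 / β * (n * (4 * exitProb H * δ ^ 2 * (1 / m))) := by
  set P := alg.outputLaw (hardMDP hm (erasedProb θ δ h i.succ.succ)) with hP
  rw [← sum_prob_ne P h i.succ.succ]
  set Q := fun a => alg.outputLaw (hardMDP hm (hiddenProb (θ.update h i.succ.succ a) δ)) with hQ
  have key : ∑ a, P {π | π h i.succ.succ ≠ a} ≤
      ∑ a, Q a {π | π h i.succ.succ ≠ a} + K * ENNReal.ofReal β + ENNReal.ofReal (1 / β) *
        (n * (ENNReal.ofReal (4 * exitProb H * δ ^ 2) * ENNReal.ofReal (1 / m))) := by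
    calc _ ≤ ∑ a, (Q a {π | π h i.succ.succ ≠ a} + ENNReal.ofReal β +
          ENNReal.ofReal (1 / β) * ∑ t ∈ Finset.range (n * H),
          ∫⁻ x, visitCost (ENNReal.ofReal (4 * exitProb H * δ ^ 2)) h i.succ.succ a t x
          ∂(hardMDP hm (erasedProb θ δ h i.succ.succ)).law alg.toStrategy t) := by
          refine Finset.sum_le_sum fun a _ => ?_
          refine outputLaw_le_add hm alg δ.2.1 δ.2.2 ?_ ?_ ?_ hβ _
          · simp [erasedProb]
          · simp [hiddenProb, Policy.update_same]
          · intro h' s' a' hne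
            unfold erasedProb
            split_ifs with hs
            · obtain ⟨rfl, rfl⟩ := hs
              have : a' ≠ a := fun ha => hne ⟨rfl, rfl, ha⟩
              simp [hiddenProb, Policy.update_same, this]
            · simp [hiddenProb, Policy.update_of_ne _ _ hs]
      _ ≤ _ := by
          rw [Finset.sum_add_distrib, Finset.sum_add_distrib, ← Finset.mul_sum]
          gcongr
          · simp
          · exact sum_visitCost_le hm _ _ _
  have hq := exitProb_pos (H := H)
  have hP' : ∑ a, P {π | π h i.succ.succ ≠ a} =
      ENNReal.ofReal (∑ a, P.real {π | π h i.succ.succ ≠ a}) := by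
    rw [ENNReal.ofReal_sum_of_nonneg fun _ _ => measureReal_nonneg]
    simp
  have hQ' : ∑ a, Q a {π | π h i.succ.succ ≠ a} =
      ENNReal.ofReal (∑ a, (Q a).real {π | π h i.succ.succ ≠ a}) := by
    rw [ENNReal.ofReal_sum_of_nonneg fun _ _ => measureReal_nonneg]
    exact Finset.sum_congr rfl fun a _ => by
      have : IsProbabilityMeasure (Q a) := by rw [hQ]; infer_instance
      simp
  have hS : 0 ≤ ∑ a, (Q a).real {π | π h i.succ.succ ≠ a} :=
    Finset.sum_nonneg fun _ _ => measureReal_nonneg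
  rw [hP', hQ', ← ENNReal.ofReal_natCast K, ← ENNReal.ofReal_natCast n,
    ← ENNReal.ofReal_mul (by positivity), ← ENNReal.ofReal_mul (by positivity),
    ← ENNReal.ofReal_mul (by positivity), ← ENNReal.ofReal_mul (by positivity),
    ← ENNReal.ofReal_add hS (by positivity), ← ENNReal.ofReal_add (by positivity) (by positivity),
    ENNReal.ofReal_le_ofReal_iff (by positivity)] at key
  exact key

/-- The number of relevant states in which the policy `π` does not follow `θ`. -/
def mismatches (θ π : Policy H (m + 2) K) : ℕ :=
  ∑ j ∈ Finset.range (H - 1), ∑ i : Fin m,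
    if π (layer H j) i.succ.succ ≠ θ (layer H j) i.succ.succ then 1 else 0

theorem mismatches_le (θ π : Policy H (m + 2) K) : mismatches θ π ≤ (H - 1) * m := by
  unfold mismatches
  calc _ ≤ ∑ j ∈ Finset.range (H - 1), ∑ i : Fin m, 1 := by
        gcongr; split_ifs <;> simp
    _ = _ := by simp

/-- It suffices to compare with θ, since the optimal value is at least that of θ. -/
theorem value_gap (θ π : Policy H (m + 2) K) :
    mismatches θ π * ((δ : ℝ) / (4 * H * m)) ≤
      (hardMDP hm (hiddenProb θ δ)).optValue - (hardMDP hm (hiddenProb θ δ)).value π := by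
  have h1 : (hardMDP hm (hiddenProb θ δ)).value θ ≤ (hardMDP hm (hiddenProb θ δ)).optValue :=
    le_ciSup (Set.finite_range _).bddAbove θ
  refine le_trans ?_ (sub_le_sub_right h1 _)
  rw [value_hardMDP, value_hardMDP, ← Finset.sum_sub_distrib, mismatches]
  push_cast
  rw [Finset.sum_mul]
  refine Finset.sum_le_sum fun j hj => ?_
  rw [← Finset.sum_sub_distrib, Finset.sum_mul]
  refine Finset.sum_le_sum fun i _ => ?_
  have hw := exit_weight_ge (H := H) (j := j) (by have := Finset.mem_range.1 hj; omega) hm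
  have hδ := δ.2.1
  by_cases hπ : π (layer H j) i.succ.succ = θ (layer H j) i.succ.succ
  · simp [hπ]
  · simp only [hiddenProb, hπ, if_true, if_false, ne_eq, not_false_eq_true]
    have := mul_le_mul_of_nonneg_right hw hδ
    calc (1 : ℝ) * ((δ : ℝ) / (4 * H * m)) = 1 / (4 * H * m) * δ := by ring
      _ ≤ _ := this
      _ = _ := by ring

theorem integral_mismatches (θ : Policy H (m + 2) K) (P : Measure (Policy H (m + 2) K))
    [IsProbabilityMeasure P] :
    ∫ π, (mismatches θ π : ℝ) ∂P = ∑ j ∈ Finset.range (H - 1), ∑ i : Fin m,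
      P.real {π | π (layer H j) i.succ.succ ≠ θ (layer H j) i.succ.succ} := by
  unfold mismatches
  push_cast
  rw [integral_finsetSum _ fun _ _ => Integrable.of_finite]
  refine Finset.sum_congr rfl fun j _ => ?_
  rw [integral_finsetSum _ fun _ _ => Integrable.of_finite]
  refine Finset.sum_congr rfl fun i _ => ?_
  rw [← integral_indicator_one (Set.toFinite _).measurableSet]
  simp [Set.indicator_apply]

/-- If the output is nearly optimal with high probability, few mismatches are expected. -/
theorem integral_mismatches_lt (θ : Policy H (m + 2) K) {ε : ℝ} (hε : 0 < ε) (hδ : δ = 32 * ε)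
    (hH : 2 ≤ H) (P : Measure (Policy H (m + 2) K)) [IsProbabilityMeasure P]
    (hP : 11 / 12 < P.real {π | (hardMDP hm (hiddenProb θ δ)).optValue - ε ≤
      (hardMDP hm (hiddenProb θ δ)).value π}) :
    ∫ π, (mismatches θ π : ℝ) ∂P < ((H : ℝ) - 1) * m / 3 := by
  set S := {π | (hardMDP hm (hiddenProb θ δ)).optValue - ε ≤
    (hardMDP hm (hiddenProb θ δ)).value π} with hS
  have hSm : MeasurableSet S := (Set.toFinite _).measurableSet
  have hH' : (2 : ℝ) ≤ H := by exact_mod_cast hH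
  have hm' : (0 : ℝ) < m := by exact_mod_cast hm
  have hD : (0 : ℝ) < (H - 1) * m := mul_pos (by linarith) hm'
  have hpt : ∀ π, (mismatches θ π : ℝ) ≤
      (H - 1) * m / 4 + (H - 1) * m * Sᶜ.indicator 1 π := fun π => by
    by_cases hπ : π ∈ S
    · have h1 := value_gap hm δ θ π
      have h2 : (hardMDP hm (hiddenProb θ δ)).optValue - ε ≤
        (hardMDP hm (hiddenProb θ δ)).value π := hπ
      have h3 : mismatches θ π * ((δ : ℝ) / (4 * H * m)) ≤ ε := by linarith
      rw [hδ, mul_div_assoc', div_le_iff₀ (by positivity)] at h3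
      have h4 : (mismatches θ π : ℝ) * 8 ≤ H * m := by
        refine le_of_mul_le_mul_right ?_ hε
        linarith
      simp only [Set.mem_compl_iff, hπ, not_true_eq_false, not_false_eq_true,
        Set.indicator_of_notMem, mul_zero, add_zero]
      nlinarith
    · have h1 : (mismatches θ π : ℝ) ≤ (H - 1) * m := by
        have : (mismatches θ π : ℝ) ≤ ((H - 1 : ℕ) : ℝ) * m := by exact_mod_cast mismatches_le θ π
        rwa [Nat.cast_sub (by omega), Nat.cast_one] at this
      simp only [Set.mem_compl_iff, hπ, not_false_eq_true, Set.indicator_of_mem, Pi.one_apply]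
      linarith
  calc ∫ π, (mismatches θ π : ℝ) ∂P
      ≤ ∫ π, (((H : ℝ) - 1) * m / 4 + (H - 1) * m * Sᶜ.indicator 1 π) ∂P :=
        integral_mono Integrable.of_finite Integrable.of_finite hpt
    _ = ((H : ℝ) - 1) * m / 4 + (H - 1) * m * (1 - P.real S) := by
        rw [integral_add Integrable.of_finite Integrable.of_finite, integral_const_mul,
          integral_indicator_one hSm.compl, probReal_compl_eq_one_sub hSm]
        simp
    _ < _ := by nlinarith

end

/-- Averaged over the hidden policy, the optimal action of a state is missed with probability at
least `1 / 3` if there are few episodes. -/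
theorem sum_prob_ne_ge (hm : 0 < m) (δ : Set.Icc (0 : ℝ) (1 / 4)) (alg : Algorithm H (m + 2) K n)
    (hK : 2 ≤ K) (hn : (n : ℝ) * δ ^ 2 ≤ m * K * H / 288) (h : Fin H) (i : Fin m) :
    (Fintype.card (Policy H (m + 2) K) : ℝ) / 3 ≤
      ∑ θ, (alg.outputLaw (hardMDP hm (hiddenProb θ δ))).real
        {π | π h i.succ.succ ≠ θ h i.succ.succ} := by
  have hK' : (2 : ℝ) ≤ K := by exact_mod_cast hK
  have hH : (0 : ℝ) < H := by exact_mod_cast NeZero.pos H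
  have hm' : (0 : ℝ) < m := by exact_mod_cast hm
  have h1 := sum_sum_update (fun θ => (alg.outputLaw (hardMDP hm (hiddenProb θ δ))).real
    {π | π h i.succ.succ ≠ θ h i.succ.succ}) h i.succ.succ
  -- With β = 1/12 the information term is 24nδ²/(Hm), whence the constant 288 = 24 · 12.
  have hsmall : 1 / (1 / 12) * (n * (4 * exitProb H * δ ^ 2 * (1 / m))) ≤ (K : ℝ) / 12 := by
    have : 1 / (1 / 12) * (n * (4 * exitProb H * δ ^ 2 * (1 / m))) =
        24 * (n * (δ : ℝ) ^ 2) / (H * m) := by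
      unfold exitProb; field_simp; ring
    rw [this, div_le_iff₀ (by positivity)]
    linarith
  have h2 : ∀ θ : Policy H (m + 2) K, (K : ℝ) / 3 ≤
      ∑ a, (alg.outputLaw (hardMDP hm (hiddenProb (θ.update h i.succ.succ a) δ))).real
        {π | π h i.succ.succ ≠ θ.update h i.succ.succ a h i.succ.succ} := fun θ => by
    -- Since K ≥ 2, K - 1 - K/12 - K/12 ≥ K/2 - K/6 = K/3.
    have := sum_prob_ne_update_ge hm δ alg θ h i (show (0 : ℝ) < 1 / 12 by norm_num)
    simp only [Policy.update_same]
    linarith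
  have h3 := Finset.sum_le_sum fun θ (_ : θ ∈ Finset.univ) => h2 θ
  rw [h1, Finset.sum_const, Finset.card_univ, nsmul_eq_mul] at h3
  refine le_of_mul_le_mul_left ?_ (by linarith : (0 : ℝ) < K)
  linarith

theorem exists_hard_instance (hm : 0 < m) (hH : 2 ≤ H) (hK : 2 ≤ K) {ε : ℝ} (hε : 0 < ε)
    (hε' : 32 * ε ≤ 1 / 4) (hn : (n : ℝ) * (32 * ε) ^ 2 ≤ m * K * H / 288)
    (alg : Algorithm H (m + 2) K n) :
    ∃ mdp : LayeredMDP H (m + 2) K, mdp.BoundedRewards ∧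
      alg.outputLaw mdp {π | mdp.optValue - ε ≤ mdp.value π} ≤ 11 / 12 := by
  set δ : Set.Icc (0 : ℝ) (1 / 4) := ⟨32 * ε, by positivity, hε'⟩ with hδ
  by_contra! hcon
  have hP : ∀ θ : Policy H (m + 2) K,
      ∫ π, (mismatches θ π : ℝ) ∂alg.outputLaw (hardMDP hm (hiddenProb θ δ)) <
        (H - 1) * m / 3 := fun θ => by
    refine integral_mismatches_lt hm δ θ hε rfl hH _ ?_
    have h1 := hcon _ (boundedRewards_hardMDP hm (hiddenProb θ δ))
    rw [← ENNReal.toReal_lt_toReal (ENNReal.div_ne_top (by simp) (by simp))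
      (measure_ne_top _ _)] at h1
    simpa [Measure.real] using h1
  -- Policies exist, so the strict inequality survives summation over θ.
  have : Nonempty (Fin K) := ⟨⟨0, by omega⟩⟩
  have h1 := Finset.sum_lt_sum_of_nonempty Finset.univ_nonempty
    fun θ (_ : θ ∈ (Finset.univ : Finset (Policy H (m + 2) K))) => hP θ
  simp only [integral_mismatches] at h1
  rw [Finset.sum_comm] at h1
  simp_rw [Finset.sum_comm (s := (Finset.univ : Finset (Policy H (m + 2) K)))
    (t := (Finset.univ : Finset (Fin m)))] at h1
  have h2 := Finset.sum_le_sum fun j (_ : j ∈ Finset.range (H - 1)) =>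
    Finset.sum_le_sum fun i (_ : i ∈ (Finset.univ : Finset (Fin m))) =>
      sum_prob_ne_ge hm δ alg hK hn (layer H j) i
  have h3 := h2.trans_lt h1
  simp only [Finset.sum_const, Finset.card_univ, Finset.card_range, Fintype.card_fin,
    nsmul_eq_mul, Nat.cast_sub (by omega : 1 ≤ H), Nat.cast_one] at h3
  linarith

end EpisodicRL

theorem mainTheorem5 :
    ∃ c : ℝ, 0 < c ∧
      ∀ (M H K : ℕ) [NeZero H], 4 ≤ M → 2 ≤ H → 2 ≤ K →
      ∀ ε : ℝ, 0 < ε → ε < 1 / (48 * Real.sqrt 8) →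
      ∀ n : ℕ, (n : ℝ) ≤ c * M * K * H / ε ^ 2 →
      ∀ alg : EpisodicRL.Algorithm H M K n,
        ∃ mdp : EpisodicRL.LayeredMDP H M K,
          mdp.BoundedRewards ∧
          alg.outputLaw mdp {π | mdp.optValue - ε ≤ mdp.value π} ≤ 11 / 12 := by
  -- It suffices that 2 · 32² · 288 = 589824 ≤ 10⁶, the factor 2 coming from M = m + 2 ≤ 2m.
  refine ⟨1 / 10 ^ 6, by norm_num, ?_⟩
  intro M H K _ hM hH hK ε hε hε' n hn alg
  obtain ⟨m, rfl⟩ := Nat.exists_eq_add_of_le' (by omega : 2 ≤ M)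
  have hm : (2 : ℝ) ≤ m := by exact_mod_cast (by omega : 2 ≤ m)
  refine EpisodicRL.exists_hard_instance (by omega) hH hK hε ?_ ?_ alg
  · have h8 : (8 / 3 : ℝ) ≤ √8 := Real.le_sqrt_of_sq_le (by norm_num)
    have : 1 / (48 * √8) ≤ 1 / (48 * (8 / 3)) := by gcongr
    have : (1 : ℝ) / (48 * (8 / 3)) = 1 / 128 := by norm_num
    linarith
  · rw [le_div_iff₀ (by positivity)] at hn
    have hKH : (0 : ℝ) ≤ K * H := by positivity
    have : ((m + 2 : ℕ) : ℝ) * (K * H) ≤ (2 * m) * (K * H) := by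
      gcongr
      push_cast
      linarith
    have h0 : 0 ≤ (m : ℝ) * (K * H) := by positivity
    linarith
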